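/- A composition is a finite list $\alpha=(\alpha_1,\dots,\alpha_{\ell(\alpha)})$ of positive integers, with size $|\alpha|=\sum_i\alpha_i$; it is a partition if its parts weakly decrease. Its diagram has $\alpha_i$ left-justified cells in row $i$, rows being numbered from the bottom. For compositions $\lambda$ and $\alpha$, $\lambda\subseteq\alpha$ means that $\ell(\lambda)\le\ell(\alpha)$ and $\lambda_i\le\alpha_i$ for all $i\le\ell(\lambda)$; then $\alpha/\lambda$ is the diagram of the cells of $\alpha$ that are not in $\lambda$, where $\lambda$ is placed in the bottom-left corner of $\alpha$, and $|\alpha/\lambda|=|\alpha|-|\lambda|$. The diagram $\alpha/\lambda$ is connected if its rows cannot be partitioned into two nonempty sets $R_1,R_2$ such that no column contains both a cell in a row of $R_1$ and a cell in a row of $R_2$. The weakly advanced extended function of $\alpha/\lambda$ is the formal power series $$\mathcal{A}\mathcal{E}_{\alpha/\lambda}=\sum_T\ \prod_{c\in\alpha/\lambda}x_{T(c)}\in\mathbb{Q}[[x_1,x_2,\dots]],$$ where $T$ runs over all fillings of the cells of $\alpha/\lambda$ with positive integers that weakly increase along every row from left to right and along every column from bottom to top. A power series is called symmetric if it is a (finite)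 $\mathbb{Q}$-linear combination of monomial symmetric functions. **Theorem.** Let $\alpha$ be a nonempty composition and $\lambda$ a (possibly empty) partition with $\lambda\subseteq\alpha$, such that $\alpha/\lambda$ is connected and each of its rows $1,\dots,\ell(\alpha)$ contains at least one cell. Then $\mathcal{A}\mathcal{E}_{\alpha/\lambda}$ is symmetric if and only if, for some $0\le k\le|\alpha/\lambda|-1$, the diagram $\alpha/\lambda$ is, up to a horizontal translation, the diagram of the composition $(1^k,|\alpha/\lambda|-k)=(1,\dots,1,|\alpha/\lambda|-k)$ with $k$ ones. -/

import Mathlib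

/-! Skew diagrams of compositions, their weakly increasing tableaux, and symmetric functions.
Rows (from the bottom) and columns (from the left) are numbered from `0`. -/

noncomputable section

namespace SkewComp

/-- The `i`-th part of a composition (numbered from `0`), read as `0` beyond the last part. -/
def part {n : ℕ} (c : Composition n) (i : ℕ) : ℕ := c.blocks.getD i 0

/-- A composition is a partition if its parts weakly decrease. -/
def IsPartition {n : ℕ} (c : Composition n) : Prop := c.blocks.Pairwise (· ≥ ·)

/-- Containment `β ⊆ α` of compositions. -/
def Contained {m n : ℕ} (β : Composition m) (α : Composition n) : Prop :=
  β.length ≤ α.length ∧ ∀ i < β.length, part β i ≤ part α i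

/-- The cells of the (skew) diagram `α / β`, as pairs (row, column): those cells of `α` that are
not cells of `β`, when `β` is placed in the bottom-left corner of `α`. -/
def cells {n m : ℕ} (α : Composition n) (β : Composition m) : Finset (ℕ × ℕ) :=
  (Finset.range α.length ×ˢ Finset.range n).filter
    fun c => part β c.1 ≤ c.2 ∧ c.2 < part α c.1

/-- The bound on the columns in the definition of `cells` excludes nothing. -/
theorem mem_cells {n m : ℕ} (α : Composition n) (β : Composition m) (i j : ℕ) :
    (i, j) ∈ cells α β ↔ i < α.length ∧ part β i ≤ j ∧ j < part α i := by
  have key : i < α.length → part α i ≤ n := by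
    intro hi
    have h : part α i = α.blocks[i] := List.getD_eq_getElem _ _ hi
    rw [h]
    exact (List.le_sum_of_mem (List.getElem_mem hi)).trans_eq α.blocks_sum
  simp only [cells, Finset.mem_filter, Finset.mem_product, Finset.mem_range]
  constructor
  · rintro ⟨⟨h1, -⟩, h2⟩
    exact ⟨h1, h2⟩
  · rintro ⟨h1, h2, h3⟩
    exact ⟨⟨h1, h3.trans_le (key h1)⟩, h2, h3⟩

/-- Every row of the diagram `α / β` contains at least one cell. -/
def RowsNonempty {n m : ℕ} (α : Composition n) (β : Composition m) : Prop :=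
  ∀ i < α.length, ∃ j, (i, j) ∈ cells α β

/-- The set of columns that contain a cell of `α / β` lying in one of the rows in `R`. -/
def columns {n m : ℕ} (α : Composition n) (β : Composition m) (R : Set ℕ) : Set ℕ :=
  {j | ∃ i ∈ R, (i, j) ∈ cells α β}

/-- The diagram `α / β` is connected: its rows cannot be partitioned into two (nonempty) sets
whose cells span disjoint sets of columns. -/
def Connected {n m : ℕ} (α : Composition n) (β : Composition m) : Prop :=
  ¬ ∃ R₁ R₂ : Set ℕ, R₁.Nonempty ∧ R₂.Nonempty ∧ Disjoint R₁ R₂ ∧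
    R₁ ∪ R₂ = {i | i < α.length} ∧ Disjoint (columns α β R₁) (columns α β R₂)

/-- A filling of the cells of `α / β` with positive integers. -/
abbrev Tableau {n m : ℕ} (α : Composition n) (β : Composition m) : Type :=
  {c // c ∈ cells α β} → ℕ+

/-- The entries weakly increase along each row from left to right and along each column from
bottom to top. Two cells of a column are compared also when there is a gap between them. -/
def IsWeak {n m : ℕ} {α : Composition n} {β : Composition m} (T : Tableau α β) : Prop :=
  (∀ c d, c.1.1 = d.1.1 → c.1.2 ≤ d.1.2 → T c ≤ T d) ∧
    (∀ c d, c.1.2 = d.1.2 → c.1.1 ≤ d.1.1 → T c ≤ T d)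

/-- The content of a tableau: the function that counts the occurrences of each entry. It is also
the exponent of the monomial of the tableau. -/
def content {n m : ℕ} {α : Composition n} {β : Composition m} (T : Tableau α β) : ℕ+ →₀ ℕ :=
  ∑ c, Finsupp.single (T c) 1

/-- Only finitely many tableaux of a given shape have a given content. -/
theorem finite_content {n m : ℕ} (α : Composition n) (β : Composition m) (d : ℕ+ →₀ ℕ) :
    {T : Tableau α β | IsWeak T ∧ content T = d}.Finite := by
  refine (Set.Finite.pi' (fun _ => d.support.finite_toSet)).subset ?_
  rintro T ⟨-, rfl⟩ c
  simp only [Finset.mem_coe, Finsupp.mem_support_iff, content, Finsupp.finsetSum_apply]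
  have h := Finset.single_le_sum (f := fun e => Finsupp.single (T e) 1 (T c))
    (fun _ _ => Nat.zero_le _) (Finset.mem_univ c)
  simp only [Finsupp.single_eq_same] at h
  omega

/-- The weakly advanced extended function of `α / β`, i.e. the formal power series `∑ x^T` over
all tableaux `T` of shape `α / β` whose rows and columns weakly increase: the coefficient of a
monomial is the number of such tableaux that have it as their monomial. -/
def weakAdvExt {n m : ℕ} (α : Composition n) (β : Composition m) : MvPowerSeries ℕ+ ℚ :=
  fun d => (Set.ncard {T : Tableau α β | IsWeak T ∧ content T = d} : ℚ)

open Classical in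
/-- The monomial symmetric function `m_μ`: the sum of all distinct monomials whose nonzero
exponents are, up to order, the parts of `μ`. -/
def monomialSymm {n : ℕ} (μ : n.Partition) : MvPowerSeries ℕ+ ℚ :=
  fun d => if d.support.val.map d = μ.parts then 1 else 0

/-- The homogeneous symmetric functions of degree `n`. -/
def SymDeg (n : ℕ) : Submodule ℚ (MvPowerSeries ℕ+ ℚ) :=
  Submodule.span ℚ (Set.range (monomialSymm (n := n)))

/-- The space of symmetric functions in the variables `x_1, x_2, …` over `ℚ`. -/
def Sym : Submodule ℚ (MvPowerSeries ℕ+ ℚ) := ⨆ n, SymDeg n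

/-- The composition `(1^k, N - k)` of `N`, for `k < N`. -/
def onesThen (N k : ℕ) (hk : k < N) : Composition N where
  blocks := List.replicate k 1 ++ [N - k]
  blocks_pos := by
    intro i hi
    rw [List.mem_append, List.mem_replicate, List.mem_singleton] at hi
    omega
  blocks_sum := by
    rw [List.sum_append, List.sum_replicate, List.sum_singleton, smul_eq_mul]
    omega

/-- The diagram of a composition: the case `β = ∅` of `α / β`. -/
def diagram {n : ℕ} (α : Composition n) : Finset (ℕ × ℕ) := cells α (Composition.ones 0)

/-- The diagram `α / β` equals the diagram of the composition `γ`, up to a horizontal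
translation. -/
def IsDiagramOf {n m N : ℕ} (α : Composition n) (β : Composition m) (γ : Composition N) : Prop :=
  ∃ s : ℕ, cells α β = (diagram γ).image fun c => (c.1, c.2 + s)

end SkewComp

end

/-! Weak fillings are monotone maps from the poset `Cell` generated by the row and column
comparisons. A monotone map with given multiplicities is a chain of lower sets with prescribed step
sizes, counted by an entry of a product of the matrices `stepMat`. Symmetry of the function
therefore makes these counts independent of the order of the steps (`chainCount_perm`).

The key is that order independence survives when one step is required to be an antichain: `antiMat`
is obtained from `stepMat` by the same alternating recursion that obtains elementary from complete
homogeneous symmetric functions (`sum_antiMat_mul_stepMat`, `antichain_count_perm`). An antichain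
taken as the first step consists of minimal elements, while one taken later can be more general.
Comparing the two positions shows that no antichain outnumbers the `m` minimal elements, and that
every lower set containing them has an antichain of `m` maximal elements of its own. The first fact
makes the elements above a given minimal element a chain, the second leaves only one minimal element
below each element; so the poset is a disjoint union of chains (`exists_chain_partition`).

For a connected diagram only one chain is possible. Cells in a chain have comparable coordinates,
which forces the stated shape because `λ` is a partition. Conversely, a chain of `N` cells has
exactly one filling for each content of degree `N`, so its function is the complete homogeneous one.
-/

noncomputable section

/-! ### Transfer matrices on lower sets and the antichain recursion. -/

namespace FinitePoset

open Finset
open scoped Classical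

/-- The lower sets of a finite poset, as finsets. -/
abbrev Low (P : Type*) [PartialOrder P] : Type _ := {I : Finset P // IsLowerSet (I : Set P)}

variable {P : Type*} [PartialOrder P]

/-- The empty lower set. -/
def lowBot (P : Type*) [PartialOrder P] : Low P := ⟨∅, by simp [isLowerSet_empty]⟩

/-- The lower set of all elements. -/
def lowTop (P : Type*) [PartialOrder P] [Fintype P] : Low P :=
  ⟨univ, by simp [isLowerSet_univ]⟩

/-- The matrix whose entries tell whether a lower set extends another one by `s` elements. -/
def stepMat (P : Type*) [PartialOrder P] (s : ℕ) : Matrix (Low P) (Low P) ℤ :=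
  fun J I => if J.1 ⊆ I.1 ∧ (I.1 \ J.1).card = s then 1 else 0

/-- The matrix whose entries tell whether a lower set extends another one by an antichain of `s`
elements. -/
def antiMat (P : Type*) [PartialOrder P] (s : ℕ) : Matrix (Low P) (Low P) ℤ :=
  fun J I => if J.1 ⊆ I.1 ∧ (I.1 \ J.1).card = s ∧ IsAntichain (· ≤ ·) ((I.1 \ J.1 : Finset P) : Set P)
    then 1 else 0

theorem stepMat_zero : stepMat P 0 = 1 := by
  ext J I
  simp only [stepMat, Matrix.one_apply, Finset.card_eq_zero, Finset.sdiff_eq_empty_iff_subset]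
  congr 1
  rw [Subtype.ext_iff, Finset.Subset.antisymm_iff]

theorem antiMat_zero : antiMat P 0 = 1 := by
  rw [← stepMat_zero]
  ext J I
  simp only [antiMat, stepMat, Finset.card_eq_zero]
  congr 1
  apply propext
  constructor
  · rintro ⟨h1, h2, -⟩
    exact ⟨h1, h2⟩
  · rintro ⟨h1, h2⟩
    exact ⟨h1, h2, by simp [h2]⟩

/-- The signed sum over all ways to insert a lower set between `J` and `I` that extends `J` by an
antichain vanishes. -/
theorem sum_neg_one_pow_antichain (J I : Low P) (hJI : J.1 ⊂ I.1) [Fintype P] :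
    ∑ K : Low P, (if J.1 ⊆ K.1 ∧ K.1 ⊆ I.1 ∧
      IsAntichain (· ≤ ·) ((K.1 \ J.1 : Finset P) : Set P) then (-1 : ℤ) ^ (K.1 \ J.1).card else 0)
      = 0 := by
  -- The admissible `K` are exactly the sets `J ∪ B` with `B` a subset of the minimal elements `M`
  -- of `I \ J`, so this is the alternating sum over the subsets of a nonempty set.
  set M : Finset P := (I.1 \ J.1).filter fun x => ∀ y ∈ I.1 \ J.1, y ≤ x → y = x with hM
  have hne : M.Nonempty := by
    obtain ⟨x, hx⟩ := (I.1 \ J.1).exists_minimal (Finset.sdiff_nonempty.2 hJI.2)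
    refine ⟨x, Finset.mem_filter.2 ⟨hx.1, fun y hy hyx => le_antisymm hyx (hx.2 hy hyx)⟩⟩
  have hMI : M ⊆ I.1 \ J.1 := Finset.filter_subset _ _
  rw [← Finset.sum_filter]
  rw [← Finset.sum_powerset_neg_one_pow_card_of_nonempty hne]
  refine Finset.sum_bij (fun K _ => K.1 \ J.1) ?_ ?_ ?_ (fun _ _ => rfl)
  · intro K hK
    obtain ⟨-, h1, h2, h3⟩ := Finset.mem_filter.1 hK
    rw [Finset.mem_powerset]
    intro x hx
    refine Finset.mem_filter.2 ⟨Finset.sdiff_subset_sdiff h2 (le_refl _) hx, fun y hy hyx => ?_⟩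
    refine h3.eq ?_ (by exact_mod_cast hx) hyx
    have := K.2 hyx (Finset.mem_coe.2 (Finset.mem_sdiff.1 hx).1)
    exact Finset.mem_coe.2 (Finset.mem_sdiff.2 ⟨this, (Finset.mem_sdiff.1 hy).2⟩)
  · intro K hK K' hK' h
    obtain ⟨-, h1, -⟩ := Finset.mem_filter.1 hK
    obtain ⟨-, h1', -⟩ := Finset.mem_filter.1 hK'
    apply Subtype.ext
    rw [← Finset.sdiff_union_of_subset h1, ← Finset.sdiff_union_of_subset h1', h]
  · intro B hB
    rw [Finset.mem_powerset] at hB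
    have hdisj : (J.1 ∪ B) \ J.1 = B := by
      rw [Finset.union_sdiff_left, Finset.sdiff_eq_self_iff_disjoint]
      exact Finset.disjoint_left.2 fun x hx => (Finset.mem_sdiff.1 (hMI (hB hx))).2
    have hlow : IsLowerSet ((J.1 ∪ B : Finset P) : Set P) := by
      intro x y hyx hx
      rcases Finset.mem_union.1 (Finset.mem_coe.1 hx) with h | h
      · exact Finset.mem_coe.2 (Finset.mem_union_left _ (J.2 hyx h))
      · by_cases hy : y ∈ J.1
        · exact Finset.mem_coe.2 (Finset.mem_union_left _ hy)
        · have hxM := Finset.mem_filter.1 (hB h)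
          have hyI : y ∈ I.1 := I.2 hyx (Finset.mem_sdiff.1 hxM.1).1
          rw [hxM.2 y (Finset.mem_sdiff.2 ⟨hyI, hy⟩) hyx]
          exact hx
    refine ⟨⟨J.1 ∪ B, hlow⟩, Finset.mem_filter.2 ⟨Finset.mem_univ _, Finset.subset_union_left,
      Finset.union_subset hJI.1 (hB.trans (hMI.trans Finset.sdiff_subset)), ?_⟩, hdisj⟩
    simp only [hdisj]
    intro x hx y hy hxy hle
    exact hxy ((Finset.mem_filter.1 (hB hy)).2 x (hMI (hB hx)) hle)

variable [Fintype P]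

/-- The recursion that expresses the matrices `antiMat` by the matrices `stepMat`. -/
theorem sum_antiMat_mul_stepMat {w : ℕ} (hw : 0 < w) :
    ∑ t ∈ range (w + 1), (-1 : ℤ) ^ t • (antiMat P t * stepMat P (w - t)) = 0 := by
  ext J I
  simp only [Matrix.sum_apply, Matrix.smul_apply, Matrix.mul_apply, Matrix.zero_apply,
    Finset.smul_sum]
  -- With the intermediate set `K` outermost, only `t = |K \ J|` contributes, which leaves the
  -- signed sum of `sum_neg_one_pow_antichain`.
  rw [Finset.sum_comm]
  by_cases h : J.1 ⊆ I.1 ∧ (I.1 \ J.1).card = w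
  · have hlt : J.1 ⊂ I.1 := by
      refine ⟨h.1, fun h' => ?_⟩
      rw [Finset.sdiff_eq_empty_iff_subset.2 h', Finset.card_empty] at h
      omega
    rw [← sum_neg_one_pow_antichain J I hlt]
    refine Finset.sum_congr rfl fun K _ => ?_
    by_cases hK : J.1 ⊆ K.1 ∧ K.1 ⊆ I.1 ∧ IsAntichain (· ≤ ·) ((K.1 \ J.1 : Finset P) : Set P)
    · have hcard : (K.1 \ J.1).card + (I.1 \ K.1).card = w := by
        rw [Finset.card_sdiff_of_subset hK.1, Finset.card_sdiff_of_subset hK.2.1, ← h.2,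
          Finset.card_sdiff_of_subset h.1]
        have := Finset.card_le_card hK.1
        have := Finset.card_le_card hK.2.1
        omega
      rw [if_pos hK, Finset.sum_eq_single (K.1 \ J.1).card]
      · simp only [antiMat, stepMat, hK.1, hK.2.1, hK.2.2, true_and, and_self, if_true]
        rw [if_pos (by omega)]
        simp
      · intro t _ ht
        simp [antiMat, Ne.symm ht]
      · intro hn
        exact absurd (Finset.mem_range.2 (by omega)) hn
    · rw [if_neg hK]
      refine Finset.sum_eq_zero fun t _ => ?_
      simp only [antiMat, stepMat]
      split_ifs with h1 h2
      · exact absurd ⟨h1.1, h2.1, h1.2.2⟩ hK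
      all_goals simp
  · refine Finset.sum_eq_zero fun K _ => Finset.sum_eq_zero fun t ht => ?_
    simp only [antiMat, stepMat]
    split_ifs with h1 h2
    · refine absurd ⟨h1.1.trans h2.1, ?_⟩ h
      have h3 := Finset.card_sdiff_of_subset h1.1
      have h4 := Finset.card_sdiff_of_subset h2.1
      have h5 := Finset.card_sdiff_of_subset (h1.1.trans h2.1)
      have := Finset.card_le_card h1.1
      have := Finset.card_le_card h2.1
      have := Finset.mem_range.1 ht
      omega
    all_goals simp

/-- The number of chains of lower sets with prescribed differences of sizes. -/
def chainCount (P : Type*) [PartialOrder P] [Fintype P] (l : List ℕ) : ℤ :=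
  (l.map (stepMat P)).prod (lowBot P) (lowTop P)

/-- If the chain counts do not depend on the order of the sizes, then neither do the counts of
chains in which one of the differences is required to be an antichain. -/
theorem antichain_count_perm (hsymm : ∀ l l' : List ℕ, l.Perm l' → chainCount P l = chainCount P l')
    (w : ℕ) : ∀ p q p' q' : List ℕ, (p ++ q).Perm (p' ++ q') →
      ((p.map (stepMat P)).prod * antiMat P w * (q.map (stepMat P)).prod) (lowBot P) (lowTop P) =
      ((p'.map (stepMat P)).prod * antiMat P w * (q'.map (stepMat P)).prod)
        (lowBot P) (lowTop P) := by
  induction w using Nat.strong_induction_on with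
  | _ w ih =>
    intro p q p' q' h
    rcases Nat.eq_zero_or_pos w with rfl | hw
    · simp only [antiMat_zero, mul_one, ← List.prod_append, ← List.map_append]
      exact hsymm _ _ h
    · have key := sum_antiMat_mul_stepMat (P := P) hw
      rw [Finset.sum_range_succ, Nat.sub_self, stepMat_zero, mul_one] at key
      -- Solve the recursion for its term `t = w`; the remaining terms carry smaller antichain
      -- steps, followed by an ordinary step `w - t` that can be absorbed into `q`.
      have hV : antiMat P w = (-1 : ℤ) ^ (w + 1) •
          ∑ t ∈ range w, (-1 : ℤ) ^ t • (antiMat P t * stepMat P (w - t)) := by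
        rw [eq_neg_of_add_eq_zero_left key, smul_neg, smul_smul, ← pow_add, ← neg_smul]
        have : -(-1 : ℤ) ^ (w + 1 + w) = 1 := by
          rw [Odd.neg_one_pow ⟨w, by ring⟩]; norm_num
        rw [this, one_smul]
      have expand : ∀ p q : List ℕ,
          ((p.map (stepMat P)).prod * antiMat P w * (q.map (stepMat P)).prod)
            (lowBot P) (lowTop P) = (-1 : ℤ) ^ (w + 1) * ∑ t ∈ range w, (-1 : ℤ) ^ t *
          ((p.map (stepMat P)).prod * antiMat P t * (((w - t) :: q).map (stepMat P)).prod)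
            (lowBot P) (lowTop P) := by
        intro p q
        rw [hV]
        simp only [Matrix.mul_smul, Matrix.smul_mul, Matrix.mul_sum, Matrix.sum_mul,
          Matrix.smul_apply, Matrix.sum_apply, smul_eq_mul, List.map_cons, List.prod_cons,
          Matrix.mul_assoc]
      rw [expand, expand]
      congr 1
      refine Finset.sum_congr rfl fun t ht => ?_
      congr 1
      refine ih t (Finset.mem_range.1 ht) _ _ _ _ ?_
      exact (List.perm_middle.trans (h.cons _)).trans List.perm_middle.symm

end FinitePoset

end

/-! ### Posets with symmetric chain counts are disjoint unions of chains. -/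

noncomputable section

namespace FinitePoset

open Finset
open scoped Classical

variable {P : Type*} [PartialOrder P] [Fintype P]

/-- Order independence only gives equality after summing over `E` against the nonnegative weights of
a last step. A one-sided inequality for all `E` turns this into equality wherever the weight is
nonzero. -/
theorem stepMat_mul_antiMat_eq
    (hsymm : ∀ l l' : List ℕ, l.Perm l' → chainCount P l = chainCount P l') (a w : ℕ)
    (h : (∀ E, (stepMat P a * antiMat P w) (lowBot P) E ≤ (antiMat P w * stepMat P a) (lowBot P) E) ∨
      ∀ E, (antiMat P w * stepMat P a) (lowBot P) E ≤ (stepMat P a * antiMat P w) (lowBot P) E)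
    (E : Low P) :
    (stepMat P a * antiMat P w) (lowBot P) E = (antiMat P w * stepMat P a) (lowBot P) E := by
  -- This last step size gives the chosen `E` weight `1`.
  set b := ((lowTop P).1 \ E.1).card with hb
  have key := antichain_count_perm hsymm w [a] [b] [] [a, b] (List.Perm.refl _)
  simp only [List.map_cons, List.map_nil, List.prod_cons, List.prod_nil, mul_one, one_mul] at key
  rw [← Matrix.mul_assoc (antiMat P w), Matrix.mul_apply, Matrix.mul_apply (M := antiMat P w * _)]
    at key
  have hE : stepMat P b E (lowTop P) = 1 := if_pos ⟨Finset.subset_univ _, hb.symm⟩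
  have hnn : ∀ F, 0 ≤ stepMat P b F (lowTop P) := by
    intro F
    unfold stepMat
    split_ifs <;> simp
  rcases h with h | h
  · have := (Finset.sum_eq_sum_iff_of_le
      fun F _ => mul_le_mul_of_nonneg_right (h F) (hnn F)).1 key E (Finset.mem_univ _)
    simpa [hE] using this
  · have := (Finset.sum_eq_sum_iff_of_le
      fun F _ => mul_le_mul_of_nonneg_right (h F) (hnn F)).1 key.symm E (Finset.mem_univ _)
    simpa [hE] using this.symm

theorem stepMat_mul_antiMat_apply (a w : ℕ) (E : Low P) :
    (stepMat P a * antiMat P w) (lowBot P) E =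
      ((univ.filter fun D : Low P => D.1.card = a ∧ D.1 ⊆ E.1 ∧ (E.1 \ D.1).card = w ∧
        IsAntichain (· ≤ ·) ((E.1 \ D.1 : Finset P) : Set P)).card : ℤ) := by
  rw [Matrix.mul_apply, Finset.card_filter, Nat.cast_sum]
  refine Finset.sum_congr rfl fun D _ => ?_
  simp only [stepMat, antiMat, lowBot, Finset.empty_subset, true_and, Finset.sdiff_empty]
  by_cases h : D.1.card = a <;> simp [h]

theorem antiMat_mul_stepMat_apply (a w : ℕ) (E : Low P) :
    (antiMat P w * stepMat P a) (lowBot P) E =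
      ((univ.filter fun D : Low P => (D.1.card = w ∧ IsAntichain (· ≤ ·) (D.1 : Set P)) ∧
        D.1 ⊆ E.1 ∧ (E.1 \ D.1).card = a).card : ℤ) := by
  rw [Matrix.mul_apply, Finset.card_filter, Nat.cast_sum]
  refine Finset.sum_congr rfl fun D _ => ?_
  simp only [stepMat, antiMat, lowBot, Finset.empty_subset, true_and, Finset.sdiff_empty]
  by_cases h : D.1.card = w ∧ IsAntichain (· ≤ ·) (D.1 : Set P)
  · simp only [h, true_and, if_true, one_mul, and_self]
    split_ifs <;> simp
  · simp only [h, false_and, if_false, zero_mul, Nat.cast_zero]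

/-- The minimal elements of a finite poset. -/
def minElts (P : Type*) [PartialOrder P] [Fintype P] : Finset P := univ.filter fun x => IsMin x

/-- Anything below an element of `D` is again in `D`, hence equal to it. -/
theorem subset_minElts {D : Low P} (hD : IsAntichain (· ≤ ·) (D.1 : Set P)) : D.1 ⊆ minElts P := by
  intro x hx
  refine Finset.mem_filter.2 ⟨Finset.mem_univ _, fun y hy => ?_⟩
  exact (hD.eq (D.2 hy hx) hx hy).ge

/-- The lower set of the minimal elements. -/
def lowMin (P : Type*) [PartialOrder P] [Fintype P] : Low P :=
  ⟨minElts P, fun x y hyx hx => by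
    have hx' : IsMin x := (Finset.mem_filter.1 (Finset.mem_coe.1 hx)).2
    rw [hx'.eq_of_le hyx]
    exact hx⟩

theorem isAntichain_minElts : IsAntichain (· ≤ ·) ((minElts P : Finset P) : Set P) := by
  intro x _ y hy hxy hle
  exact hxy ((Finset.mem_filter.1 (Finset.mem_coe.1 hy)).2.eq_of_le hle)

variable (hsymm : ∀ l l' : List ℕ, l.Perm l' → chainCount P l = chainCount P l')

include hsymm

/-- No antichain is larger than the set of minimal elements. -/
theorem antichain_card_le (A : Finset P) (hA : IsAntichain (· ≤ ·) (A : Set P)) :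
    A.card ≤ (minElts P).card := by
  by_contra hlt
  rw [not_le] at hlt
  set w := A.card
  -- A first step that is an antichain lies in `minElts P`, which is too small for `w` elements.
  have hR : ∀ a E, (antiMat P w * stepMat P a) (lowBot P) E = 0 := by
    intro a E
    rw [antiMat_mul_stepMat_apply, Nat.cast_eq_zero, Finset.card_eq_zero,
      Finset.filter_eq_empty_iff]
    rintro D - ⟨⟨h1, h2⟩, -⟩
    have := Finset.card_le_card (subset_minElts h2)
    omega
  -- In the lower closure of `A` the elements of `A` are maximal, so removing them leaves a lower
  -- set and `A` is a possible second step.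
  let E : Low P := ⟨univ.filter fun x => ∃ y ∈ A, x ≤ y, by
    intro x y hyx hx
    obtain ⟨-, z, hz, hxz⟩ := Finset.mem_filter.1 (Finset.mem_coe.1 hx)
    exact Finset.mem_coe.2 (Finset.mem_filter.2 ⟨Finset.mem_univ _, z, hz, hyx.trans hxz⟩)⟩
  have hAE : A ⊆ E.1 := fun x hx => Finset.mem_filter.2 ⟨Finset.mem_univ _, x, hx, le_rfl⟩
  let D : Low P := ⟨E.1 \ A, by
    intro x y hyx hx
    obtain ⟨hxE, hxA⟩ := Finset.mem_sdiff.1 (Finset.mem_coe.1 hx)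
    refine Finset.mem_coe.2 (Finset.mem_sdiff.2 ⟨E.2 hyx hxE, fun hyA => ?_⟩)
    obtain ⟨-, z, hz, hxz⟩ := Finset.mem_filter.1 hxE
    have := hA.eq hyA hz (hyx.trans hxz)
    subst this
    exact hxA (le_antisymm hxz hyx ▸ hyA)⟩
  have hED : E.1 \ D.1 = A := Finset.sdiff_sdiff_eq_self hAE
  have h0 := stepMat_mul_antiMat_eq hsymm D.1.card w (Or.inr fun F => by
    rw [hR, stepMat_mul_antiMat_apply]
    exact Nat.cast_nonneg _) E
  rw [hR, stepMat_mul_antiMat_apply, Nat.cast_eq_zero, Finset.card_eq_zero,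
    Finset.filter_eq_empty_iff] at h0
  refine h0 (Finset.mem_univ D) ⟨rfl, Finset.sdiff_subset, ?_⟩
  rw [hED]
  exact ⟨rfl, hA⟩

/-- A lower set that contains all minimal elements has at least as many maximal elements as there
are minimal elements. -/
theorem exists_maximal_antichain (E : Low P) (hE : minElts P ⊆ E.1) :
    ∃ A ⊆ E.1, A.card = (minElts P).card ∧ ∀ x ∈ A, ∀ y ∈ E.1, x ≤ y → y = x := by
  set m := (minElts P).card
  have hmax : ∀ (F D : Low P), D.1 ⊆ F.1 → IsAntichain (· ≤ ·) ((F.1 \ D.1 : Finset P) : Set P) →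
      ∀ x ∈ F.1 \ D.1, ∀ y ∈ F.1, x ≤ y → y = x := by
    intro F D hDF hanti x hx y hy hxy
    by_cases hyD : y ∈ D.1
    · exact absurd (D.2 hxy hyD) (Finset.mem_sdiff.1 hx).2
    · exact (hanti.eq hx (Finset.mem_coe.2 (Finset.mem_sdiff.2 ⟨hy, hyD⟩)) hxy).symm
  -- The left count is at most one: two different top antichains of size `m` in `F` would combine to
  -- a larger antichain of maximal elements. If it is one, then `F` contains every minimal element,
  -- as a missing one could be added to the antichain; so `lowMin P` is counted on the right.
  have hle : ∀ a F, (stepMat P a * antiMat P m) (lowBot P) F ≤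
      (antiMat P m * stepMat P a) (lowBot P) F := by
    intro a F
    rw [stepMat_mul_antiMat_apply, antiMat_mul_stepMat_apply, Nat.cast_le]
    rcases Finset.eq_empty_or_nonempty (univ.filter fun D : Low P => D.1.card = a ∧ D.1 ⊆ F.1 ∧
        (F.1 \ D.1).card = m ∧ IsAntichain (· ≤ ·) ((F.1 \ D.1 : Finset P) : Set P)) with h | ⟨D, hD⟩
    · rw [h]
      simp
    · refine (Finset.card_le_one.2 ?_).trans (Finset.one_le_card.2 ?_)
      · intro D₁ h₁ D₂ h₂
        have main : ∀ D₁ D₂ : Low P, (D₁.1.card = a ∧ D₁.1 ⊆ F.1 ∧ (F.1 \ D₁.1).card = m ∧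
            IsAntichain (· ≤ ·) ((F.1 \ D₁.1 : Finset P) : Set P)) →
            (D₂.1.card = a ∧ D₂.1 ⊆ F.1 ∧ (F.1 \ D₂.1).card = m ∧
            IsAntichain (· ≤ ·) ((F.1 \ D₂.1 : Finset P) : Set P)) → F.1 \ D₁.1 ⊆ F.1 \ D₂.1 := by
          rintro D₁ D₂ ⟨-, s₁, c₁, a₁⟩ ⟨-, s₂, c₂, a₂⟩ x hx
          by_contra hx2
          have hanti : IsAntichain (· ≤ ·) ((insert x (F.1 \ D₂.1) : Finset P) : Set P) := by
            rw [Finset.coe_insert]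
            refine a₂.insert ?_ ?_
            · intro y hy hne hle
              exact hne (hmax F D₂ s₂ a₂ y hy x (Finset.mem_sdiff.1 hx).1 hle)
            · intro y hy hne hle
              exact hne (hmax F D₁ s₁ a₁ x hx y (Finset.mem_sdiff.1 hy).1 hle).symm
          have := antichain_card_le hsymm _ hanti
          rw [Finset.card_insert_of_notMem hx2] at this
          omega
        obtain ⟨-, g₁⟩ := Finset.mem_filter.1 h₁
        obtain ⟨-, g₂⟩ := Finset.mem_filter.1 h₂
        apply Subtype.ext
        rw [← Finset.sdiff_sdiff_eq_self g₁.2.1, ← Finset.sdiff_sdiff_eq_self g₂.2.1,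
          Finset.Subset.antisymm (main _ _ g₁ g₂) (main _ _ g₂ g₁)]
      · obtain ⟨-, h1, h2, h3, h4⟩ := Finset.mem_filter.1 hD
        have hmin : minElts P ⊆ F.1 := by
          intro x hx
          by_contra hxF
          have hxmin : IsMin x := (Finset.mem_filter.1 hx).2
          have hxn : x ∉ F.1 \ D.1 := fun h => hxF (Finset.mem_sdiff.1 h).1
          have hanti : IsAntichain (· ≤ ·) ((insert x (F.1 \ D.1) : Finset P) : Set P) := by
            rw [Finset.coe_insert]
            refine h4.insert ?_ ?_
            · intro y hy hne hle
              exact hne (hxmin.eq_of_le hle).symm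
            · intro y hy hne hle
              exact hxF (F.2 hle (Finset.mem_sdiff.1 hy).1)
          have := antichain_card_le hsymm _ hanti
          rw [Finset.card_insert_of_notMem hxn] at this
          omega
        refine ⟨lowMin P, Finset.mem_filter.2 ⟨Finset.mem_univ _, ⟨rfl, isAntichain_minElts⟩, hmin, ?_⟩⟩
        have e1 := Finset.card_sdiff_of_subset h2
        have e2 : (F.1 \ (lowMin P).1).card = F.1.card - m := Finset.card_sdiff_of_subset hmin
        have e3 := Finset.card_le_card h2
        omega
  -- For this `E` the right count is positive because of `lowMin P`, so a top antichain of size `m`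
  -- exists.
  have heq := stepMat_mul_antiMat_eq hsymm (E.1.card - m) m (Or.inl (hle _)) E
  rw [stepMat_mul_antiMat_apply, antiMat_mul_stepMat_apply, Nat.cast_inj] at heq
  have hpos : 0 < (univ.filter fun D : Low P => D.1.card = E.1.card - m ∧ D.1 ⊆ E.1 ∧
      (E.1 \ D.1).card = m ∧ IsAntichain (· ≤ ·) ((E.1 \ D.1 : Finset P) : Set P)).card := by
    rw [heq]
    exact Finset.card_pos.2 ⟨lowMin P, Finset.mem_filter.2 ⟨Finset.mem_univ _,
      ⟨rfl, isAntichain_minElts⟩, hE, Finset.card_sdiff_of_subset hE⟩⟩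
  obtain ⟨D, hD⟩ := Finset.card_pos.1 hpos
  obtain ⟨-, -, h2, h3, h4⟩ := Finset.mem_filter.1 hD
  exact ⟨E.1 \ D.1, Finset.sdiff_subset, h3, hmax E D h2 h4⟩

/-- There is only one minimal element below each element. -/
theorem minimal_unique {x x' y : P} (hx : IsMin x) (hx' : IsMin x') (h : x ≤ y) (h' : x' ≤ y) :
    x = x' := by
  by_contra hne
  let E : Low P := ⟨minElts P ∪ univ.filter (· ≤ y), by
    intro u v hvu hu
    rcases Finset.mem_union.1 (Finset.mem_coe.1 hu) with hu | hu
    · exact Finset.mem_coe.2 (Finset.mem_union_left _ ((lowMin P).2 hvu hu))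
    · exact Finset.mem_coe.2 (Finset.mem_union_right _ (Finset.mem_filter.2
        ⟨Finset.mem_univ _, hvu.trans (Finset.mem_filter.1 hu).2⟩))⟩
  have hyE : y ∈ E.1 := Finset.mem_union_right _ (Finset.mem_filter.2 ⟨Finset.mem_univ _, le_rfl⟩)
  obtain ⟨A, hAE, hAc, hAmax⟩ := exists_maximal_antichain hsymm E Finset.subset_union_left
  -- By maximality, an element of `A` below `y` is `y`; the others are minimal elements not below
  -- `y`, hence neither `x` nor `x'`. This bounds `A` by `1 + (m - 2)`.
  have hsub : A ⊆ insert y (((minElts P).erase x).erase x') := by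
    intro z hz
    by_cases hzy : z ≤ y
    · rw [hAmax z hz y hyE hzy]
      exact Finset.mem_insert_self _ _
    · refine Finset.mem_insert_of_mem (Finset.mem_erase.2 ⟨fun e => hzy (e ▸ h'),
        Finset.mem_erase.2 ⟨fun e => hzy (e ▸ h), ?_⟩⟩)
      rcases Finset.mem_union.1 (hAE hz) with hz | hz
      · exact hz
      · exact absurd (Finset.mem_filter.1 hz).2 hzy
  have hxM : x ∈ minElts P := Finset.mem_filter.2 ⟨Finset.mem_univ _, hx⟩
  have hxM' : x' ∈ (minElts P).erase x :=
    Finset.mem_erase.2 ⟨Ne.symm hne, Finset.mem_filter.2 ⟨Finset.mem_univ _, hx'⟩⟩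
  have h1 := Finset.card_le_card hsub
  have h2 := Finset.card_insert_le y (((minElts P).erase x).erase x')
  have h3 := Finset.card_erase_of_mem hxM'
  have h4 := Finset.card_erase_of_mem hxM
  have h5 := Finset.card_pos.2 ⟨_, hxM'⟩
  omega

/-- The elements above a minimal element form a chain. -/
theorem comparable_of_minimal_le {x y y' : P} (hx : IsMin x) (h : x ≤ y) (h' : x ≤ y') :
    y ≤ y' ∨ y' ≤ y := by
  by_contra hcon
  rw [not_or] at hcon
  have hM : ∀ z ∈ (minElts P).erase x, ∀ u, x ≤ u → ¬ z ≤ u ∧ ¬ u ≤ z := by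
    intro z hz u hu
    obtain ⟨hzx, hz⟩ := Finset.mem_erase.1 hz
    have hzmin : IsMin z := (Finset.mem_filter.1 hz).2
    have : ¬ z ≤ u := fun hzu => hzx (minimal_unique hsymm hzmin hx hzu hu)
    exact ⟨this, fun huz => this (hzmin huz)⟩
  have hy : y ∉ (minElts P).erase x := fun hh => (hM y hh y h).1 le_rfl
  have hy' : y' ∉ insert y ((minElts P).erase x) := by
    rw [Finset.mem_insert, not_or]
    exact ⟨fun e => hcon.1 e.ge, fun hh => (hM y' hh y' h').1 le_rfl⟩
  -- Trading `x` for both `y` and `y'` would give an antichain of `m + 1` elements.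
  have hanti : IsAntichain (· ≤ ·)
      ((insert y' (insert y ((minElts P).erase x)) : Finset P) : Set P) := by
    rw [Finset.coe_insert, Finset.coe_insert]
    refine IsAntichain.insert (IsAntichain.insert
      (isAntichain_minElts.subset (by exact_mod_cast Finset.erase_subset _ _)) ?_ ?_) ?_ ?_
    · exact fun z hz _ => (hM z (Finset.mem_coe.1 hz) y h).1
    · exact fun z hz _ => (hM z (Finset.mem_coe.1 hz) y h).2
    · rintro z (rfl | hz) _
      · exact hcon.1
      · exact (hM z (Finset.mem_coe.1 hz) y' h').1
    · rintro z (rfl | hz) _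
      · exact hcon.2
      · exact (hM z (Finset.mem_coe.1 hz) y' h').2
  have h1 := antichain_card_le hsymm _ hanti
  have hxM : x ∈ minElts P := Finset.mem_filter.2 ⟨Finset.mem_univ _, hx⟩
  rw [Finset.card_insert_of_notMem hy', Finset.card_insert_of_notMem hy,
    Finset.card_erase_of_mem hxM] at h1
  have := Finset.card_pos.2 ⟨_, hxM⟩
  omega

/-- A finite poset whose chain counts are symmetric is a disjoint union of chains. -/
theorem exists_chain_partition : ∃ f : P → P, (∀ x y, x ≤ y → f x = f y) ∧
    ∀ x y, f x = f y → x ≤ y ∨ y ≤ x := by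
  have hex : ∀ y : P, ∃ x, IsMin x ∧ x ≤ y := by
    intro y
    obtain ⟨x, hxy, hx⟩ := (univ : Finset P).exists_le_minimal (Finset.mem_univ y)
    exact ⟨x, fun z hz => hx.2 (Finset.mem_univ z) hz, hxy⟩
  choose f hf hfle using hex
  refine ⟨f, fun x y hxy => minimal_unique hsymm (hf x) (hf y) ((hfle x).trans hxy) (hfle y),
    fun x y hxy => comparable_of_minimal_le hsymm (hf x) (hfle x) ?_⟩
  rw [hxy]
  exact hfle y

end FinitePoset

end

/-! ### Chain counts as numbers of monotone maps. -/

noncomputable section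

namespace FinitePoset

open Finset
open scoped Classical

variable {P : Type*} [PartialOrder P] [Fintype P]

/-- The monotone maps that take the value `k` exactly `l[k]` times and values below `l.length`
exactly on the lower set `I`, and that equal `l.length` outside of it. -/
structure IsFill (l : List ℕ) (I : Low P) (T : P → ℕ) : Prop where
  mono : Monotone T
  le : ∀ x, T x ≤ l.length
  mem : ∀ x, x ∈ I.1 ↔ T x < l.length
  count : ∀ k < l.length, (univ.filter fun x => T x = k).card = l.getD k 0

theorem IsFill.finite (l : List ℕ) (I : Low P) : Finite {T : P → ℕ // IsFill l I T} := by
  refine Set.Finite.to_subtype ((Set.Finite.pi' fun _ : P => Set.finite_Iic l.length).subset ?_)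
  exact fun T hT x => hT.le x

/-- Outside `J` the map already has the value `l.length`, which becomes the value on the new layer
`I \ J`; only the elements outside `I` have to be raised. -/
theorem IsFill.extend {l : List ℕ} {s : ℕ} {J I : Low P} (hJI : J.1 ⊆ I.1)
    (hs : (I.1 \ J.1).card = s) {T : P → ℕ} (hT : IsFill l J T) :
    IsFill (l ++ [s]) I fun x => if x ∈ I.1 then T x else l.length + 1 where
  mono := by
    intro x y hxy
    by_cases hy : y ∈ I.1
    · have hx : x ∈ I.1 := I.2 hxy hy
      simp only [hx, hy, if_true]
      exact hT.mono hxy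
    · simp only [hy, if_false]
      split_ifs
      · exact (hT.le x).trans (Nat.le_succ _)
      · exact le_rfl
  le := by
    intro x
    simp only [List.length_append, List.length_singleton]
    split_ifs
    · exact (hT.le x).trans (Nat.le_succ _)
    · exact le_rfl
  mem := by
    intro x
    simp only [List.length_append, List.length_singleton]
    by_cases hx : x ∈ I.1
    · simpa [hx, Nat.lt_succ_iff] using hT.le x
    · simp [hx]
  count := by
    intro k hk
    rw [List.length_append, List.length_singleton, Nat.lt_succ_iff] at hk
    rcases hk.lt_or_eq with hk | rfl
    · rw [List.getD_append _ _ _ _ hk, ← hT.count k hk]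
      congr 1
      ext x
      simp only [Finset.mem_filter, Finset.mem_univ, true_and]
      by_cases hx : x ∈ I.1
      · simp [hx]
      · have : ¬ T x < l.length := fun h => hx (hJI ((hT.mem x).2 h))
        simp only [hx, if_false]
        omega
    · rw [List.getD_append_right _ _ _ _ le_rfl, Nat.sub_self, List.getD_cons_zero, ← hs]
      congr 1
      ext x
      simp only [Finset.mem_filter, Finset.mem_univ, true_and, Finset.mem_sdiff, hT.mem]
      have := hT.le x
      by_cases hx : x ∈ I.1
      · simp only [hx, if_true, true_and]
        omega
      · simp [hx]

/-- Inverse to `IsFill.extend`: capping at `l.length` merges the last layer with the elements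
outside `I`. -/
theorem IsFill.restrict {l : List ℕ} {s : ℕ} {I : Low P} {T : P → ℕ}
    (hT : IsFill (l ++ [s]) I T) : ∃ J : Low P, J.1 ⊆ I.1 ∧ (I.1 \ J.1).card = s ∧
      IsFill l J fun x => min (T x) l.length := by
  have hmem := hT.mem
  have hle := hT.le
  have hcount := hT.count
  simp only [List.length_append, List.length_singleton] at hmem hle hcount
  refine ⟨⟨univ.filter fun x => T x < l.length, ?_⟩, ?_, ?_, ?_, ?_, ?_, ?_⟩
  · intro x y hyx hx
    simp only [Finset.coe_filter, Finset.mem_univ, true_and, Set.mem_ofPred_eq] at hx ⊢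
    exact (hT.mono hyx).trans_lt hx
  · intro x hx
    rw [hmem]
    have := (Finset.mem_filter.1 hx).2
    omega
  · have := hcount l.length (Nat.lt_succ_self _)
    rw [List.getD_append_right _ _ _ _ le_rfl, Nat.sub_self, List.getD_cons_zero] at this
    refine Eq.trans ?_ this
    congr 1
    ext x
    simp only [Finset.mem_sdiff, Finset.mem_filter, Finset.mem_univ, true_and, hmem]
    omega
  · exact fun x y hxy => min_le_min_right _ (hT.mono hxy)
  · exact fun x => min_le_right _ _
  · intro x
    simp
  · intro k hk
    have := hcount k (by omega)
    rw [List.getD_append _ _ _ _ hk] at this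
    rw [← this]
    congr 1
    ext x
    simp only [Finset.mem_filter, Finset.mem_univ, true_and]
    omega

theorem card_isFill_append (l : List ℕ) (s : ℕ) (I : Low P) :
    Nat.card {T : P → ℕ // IsFill (l ++ [s]) I T} =
      ∑ J : {J : Low P // J.1 ⊆ I.1 ∧ (I.1 \ J.1).card = s},
        Nat.card {T : P → ℕ // IsFill l J.1 T} := by
  have : ∀ J : {J : Low P // J.1 ⊆ I.1 ∧ (I.1 \ J.1).card = s},
      Finite {T : P → ℕ // IsFill l J.1 T} := fun J => IsFill.finite l J.1
  rw [← Nat.card_sigma]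
  symm
  refine Nat.card_congr (Equiv.ofBijective
    (fun p => ⟨_, p.2.2.extend p.1.2.1 p.1.2.2⟩) ⟨?_, ?_⟩)
  · rintro ⟨⟨J, hJ, hJs⟩, T, hT⟩ ⟨⟨J', hJ', hJs'⟩, T', hT'⟩ h
    have h' := congrFun (Subtype.ext_iff.1 h)
    simp only at h'
    have hTT : T = T' := by
      funext x
      by_cases hx : x ∈ I.1
      · simpa [hx] using h' x
      · have h1 : ¬ T x < l.length := fun h => hx (hJ ((hT.mem x).2 h))
        have h2 : ¬ T' x < l.length := fun h => hx (hJ' ((hT'.mem x).2 h))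
        have := hT.le x
        have := hT'.le x
        omega
    subst hTT
    have hJJ : J = J' := by
      apply Subtype.ext
      ext x
      rw [hT.mem, hT'.mem]
    subst hJJ
    rfl
  · rintro ⟨T, hT⟩
    obtain ⟨J, hJ, hJs, hr⟩ := hT.restrict
    refine ⟨⟨⟨J, hJ, hJs⟩, _, hr⟩, Subtype.ext (funext fun x => ?_)⟩
    have hmem := hT.mem x
    have hle := hT.le x
    simp only [List.length_append, List.length_singleton] at hmem hle
    by_cases hx : x ∈ I.1
    · have := hmem.1 hx
      simp only [hx, if_true]
      omega
    · simp only [hx, if_false, false_iff] at hmem ⊢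
      omega

theorem prod_stepMat_apply (l : List ℕ) : ∀ I : Low P,
    (l.map (stepMat P)).prod (lowBot P) I = (Nat.card {T : P → ℕ // IsFill l I T} : ℤ) := by
  induction l using List.reverseRecOn with
  | nil =>
    intro I
    rw [List.map_nil, List.prod_nil, Matrix.one_apply]
    split_ifs with h
    · subst h
      have : Unique {T : P → ℕ // IsFill [] (lowBot P) T} :=
        { default := ⟨fun _ => 0, ⟨fun _ _ _ => le_rfl, fun _ => le_rfl, by simp [lowBot], by simp⟩⟩
          uniq := fun T => Subtype.ext (funext fun x => Nat.le_zero.1 (T.2.le x)) }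
      rw [Nat.card_unique, Nat.cast_one]
    · have : IsEmpty {T : P → ℕ // IsFill [] I T} := ⟨fun T => h (Subtype.ext
        (Finset.eq_empty_of_forall_notMem fun x hx =>
          Nat.not_lt_zero _ ((T.2.mem x).1 hx)).symm)⟩
      rw [Nat.card_of_isEmpty, Nat.cast_zero]
  | append_singleton l s ih =>
    intro I
    rw [List.map_append, List.prod_append, List.map_singleton, List.prod_singleton,
      Matrix.mul_apply, card_isFill_append, Nat.cast_sum,
      ← Finset.sum_subtype
        (univ.filter fun J : Low P => J.1 ⊆ I.1 ∧ (I.1 \ J.1).card = s) (by simp)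
        (fun J => (Nat.card {T : P → ℕ // IsFill l J T} : ℤ)), Finset.sum_filter]
    refine Finset.sum_congr rfl fun J _ => ?_
    rw [ih, stepMat, mul_ite, mul_one, mul_zero]

/-- The finitely supported function on the positive integers whose values are the entries of a
list, followed by zeros. -/
def listContent (l : List ℕ) : ℕ+ →₀ ℕ := Finsupp.equivMapDomain Equiv.pnatEquivNat.symm l.toFinsupp

theorem listContent_apply (l : List ℕ) (k : ℕ+) : listContent l k = l.getD k.natPred 0 := rfl

/-- Together with `coeff_eq_of_mem_Sym`, this shows that permuting `l` does not change the
coefficient of a symmetric function at `listContent l`. -/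
theorem map_support_listContent (l : List ℕ) :
    (listContent l).support.val.map (listContent l) = (l : Multiset ℕ).filter (· ≠ 0) := by
  have h1 : (listContent l).support.val = l.toFinsupp.support.val.map Equiv.pnatEquivNat.symm := rfl
  have h2 : (l : Multiset ℕ) = (Multiset.range l.length).map fun i => l.getD i 0 := by
    rw [← Multiset.coe_range, Multiset.map_coe]
    congr 1
    refine List.ext_getElem (by simp) fun i h _ => ?_
    simp [h]
  rw [h1, Multiset.map_map]
  conv_rhs => rw [h2]
  rw [Multiset.filter_map, List.toFinsupp_support]
  refine Multiset.map_congr ?_ ?_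
  · rfl
  · intro i _
    simp [listContent_apply]

/-- The chain counts are the numbers of monotone maps to the positive integers with given numbers
of occurrences of the values. -/
theorem chainCount_eq (l : List ℕ) : chainCount P l =
    (Nat.card {T : P → ℕ+ // Monotone T ∧ ∑ c, Finsupp.single (T c) 1 = listContent l} : ℤ) := by
  rw [chainCount, prod_stepMat_apply]
  congr 1
  have hc : ∀ (T : P → ℕ+) (k : ℕ+), (∑ c, Finsupp.single (T c) (1 : ℕ)) k =
      (univ.filter fun c => T c = k).card := by
    intro T k
    rw [Finsupp.finsetSum_apply, Finset.card_filter]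
    simp only [Finsupp.single_apply]
  refine Nat.card_congr
    { toFun := fun T => ⟨fun c => (T.1 c).succPNat, fun x y h => ?_, ?_⟩
      invFun := fun T => ⟨fun c => (T.1 c).natPred, ⟨fun x y h => ?_, ?_, ?_, ?_⟩⟩
      left_inv := fun T => Subtype.ext (funext fun c => Nat.natPred_succPNat _)
      right_inv := fun T => Subtype.ext (funext fun c => PNat.succPNat_natPred _) }
  · exact Nat.succPNat_le_succPNat.2 (T.2.mono h)
  · ext k
    rw [hc, listContent_apply]
    have e : ∀ c, (T.1 c).succPNat = k ↔ T.1 c = k.natPred := fun c =>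
      ⟨fun h => by rw [← h, Nat.natPred_succPNat], fun h => by rw [h, PNat.succPNat_natPred]⟩
    simp only [e]
    rcases lt_or_ge k.natPred l.length with hk | hk
    · exact T.2.count _ hk
    · rw [List.getD_eq_default _ _ hk, Finset.card_eq_zero, Finset.filter_eq_empty_iff]
      intro c _ h
      have := (T.2.mem c).1 (Finset.mem_univ c)
      omega
  all_goals
    -- A value beyond the list has prescribed multiplicity `0`, so it cannot occur.
    have hlt : ∀ c, (T.1 c).natPred < l.length := by
      intro c
      by_contra hcon
      have h1 := hc T.1 (T.1 c)
      rw [T.2.2, listContent_apply, List.getD_eq_default _ _ (not_lt.1 hcon)] at h1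
      exact Finset.notMem_empty c (Finset.card_eq_zero.1 h1.symm ▸
        Finset.mem_filter.2 ⟨Finset.mem_univ c, rfl⟩)
  · exact PNat.natPred_le_natPred.2 (T.2.1 h)
  · exact fun c => (hlt c).le
  · exact fun c => ⟨fun _ => hlt c, fun _ => Finset.mem_univ c⟩
  · intro k hk
    have h1 := hc T.1 k.succPNat
    rw [T.2.2, listContent_apply, Nat.natPred_succPNat] at h1
    rw [h1]
    congr 1
    ext c
    simp only [Finset.mem_filter, Finset.mem_univ, true_and]
    exact ⟨fun h => by rw [← h, PNat.succPNat_natPred], fun h => by rw [h, Nat.natPred_succPNat]⟩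

end FinitePoset

end

/-! ### The poset of cells, and the use of connectedness. -/

noncomputable section

namespace SkewComp

open FinitePoset

/-- The coefficients of a symmetric function depend only on the multiset of nonzero exponents. -/
theorem coeff_eq_of_mem_Sym {f : MvPowerSeries ℕ+ ℚ} (hf : f ∈ Sym) {d e : ℕ+ →₀ ℕ}
    (h : d.support.val.map d = e.support.val.map e) : f d = f e := by
  let S : Submodule ℚ (MvPowerSeries ℕ+ ℚ) :=
    { carrier := {f | f d = f e}
      add_mem' := fun {f g} (hf : f d = f e) (hg : g d = g e) => by
        change f d + g d = f e + g e
        rw [hf, hg]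
      zero_mem' := rfl
      smul_mem' := fun c f (hf : f d = f e) => by
        change c * f d = c * f e
        rw [hf] }
  have hS : Sym ≤ S := by
    refine iSup_le fun n => Submodule.span_le.2 ?_
    rintro _ ⟨μ, rfl⟩
    change monomialSymm μ d = monomialSymm μ e
    simp only [monomialSymm, h]
  exact hS hf

/-- The cells of a diagram, as an ordered type. -/
structure Cell {n m : ℕ} (α : Composition n) (β : Composition m) : Type where
  /-- The position of the cell. -/
  val : {c // c ∈ cells α β}

variable {n m : ℕ} {α : Composition n} {β : Composition m}

/-- Cells correspond to positions. -/
def cellEquiv (α : Composition n) (β : Composition m) : Cell α β ≃ {c // c ∈ cells α β} where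
  toFun c := c.val
  invFun c := ⟨c⟩
  left_inv _ := rfl
  right_inv _ := rfl

instance : Fintype (Cell α β) := Fintype.ofEquiv _ (cellEquiv α β).symm

/-- The relation between two cells whose entries are compared directly. -/
def CellStep (c d : Cell α β) : Prop :=
  (c.val.1.1 = d.val.1.1 ∧ c.val.1.2 ≤ d.val.1.2) ∨ (c.val.1.2 = d.val.1.2 ∧ c.val.1.1 ≤ d.val.1.1)

theorem le_of_reflTransGen {c d : Cell α β} (h : Relation.ReflTransGen CellStep c d) :
    c.val.1.1 ≤ d.val.1.1 ∧ c.val.1.2 ≤ d.val.1.2 := by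
  induction h with
  | refl => exact ⟨le_rfl, le_rfl⟩
  | tail _ h ih =>
    rcases h with h | h <;> omega

/-- The order is generated by comparisons within rows and columns, so it may be strictly weaker than
the coordinatewise order that the subtype of positions inherits; hence the wrapper `Cell`. -/
instance : PartialOrder (Cell α β) where
  le := Relation.ReflTransGen CellStep
  le_refl _ := Relation.ReflTransGen.refl
  le_trans _ _ _ h h' := h.trans h'
  le_antisymm c d h h' := by
    have h1 := le_of_reflTransGen h
    have h2 := le_of_reflTransGen h'
    have h3 : c.val = d.val := Subtype.ext (Prod.ext (by omega) (by omega))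
    cases c
    cases d
    exact congrArg _ h3

theorem Cell.le_coord {c d : Cell α β} (h : c ≤ d) :
    c.val.1.1 ≤ d.val.1.1 ∧ c.val.1.2 ≤ d.val.1.2 := le_of_reflTransGen h

theorem isWeak_iff (T : Tableau α β) : IsWeak T ↔ Monotone fun c : Cell α β => T c.val := by
  constructor
  · intro h c d hcd
    change Relation.ReflTransGen CellStep c d at hcd
    induction hcd with
    | refl => exact le_rfl
    | tail _ h' ih =>
      refine ih.trans ?_
      rcases h' with ⟨h1, h2⟩ | ⟨h1, h2⟩
      · exact h.1 _ _ h1 h2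
      · exact h.2 _ _ h1 h2
  · intro h
    exact ⟨fun c d h1 h2 => h (a := ⟨c⟩) (b := ⟨d⟩) (Relation.ReflTransGen.single (Or.inl ⟨h1, h2⟩)),
      fun c d h1 h2 => h (a := ⟨c⟩) (b := ⟨d⟩) (Relation.ReflTransGen.single (Or.inr ⟨h1, h2⟩))⟩

theorem content_eq (T : Tableau α β) :
    content T = ∑ c : Cell α β, Finsupp.single (T c.val) 1 :=
  (Fintype.sum_equiv (cellEquiv α β) _ _ fun _ => rfl).symm

theorem weakAdvExt_eq (d : ℕ+ →₀ ℕ) : weakAdvExt α β d =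
    (Nat.card {T : Cell α β → ℕ+ // Monotone T ∧ ∑ c, Finsupp.single (T c) 1 = d} : ℚ) := by
  change ((Set.ncard {T : Tableau α β | IsWeak T ∧ content T = d} : ℕ) : ℚ) = _
  rw [← Nat.card_coe_set_eq]
  congr 1
  refine Nat.card_congr
    { toFun := fun T => ⟨fun c => T.1 c.val, (isWeak_iff _).1 T.2.1, ?_⟩
      invFun := fun T => ⟨fun c => T.1 ⟨c⟩, (isWeak_iff _).2 T.2.1, ?_⟩
      left_inv := fun T => rfl
      right_inv := fun T => rfl }
  · rw [← content_eq]
    exact T.2.2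
  · rw [content_eq]
    exact T.2.2

theorem chainCount_perm (h : weakAdvExt α β ∈ Sym) {l l' : List ℕ} (hl : l.Perm l') :
    chainCount (Cell α β) l = chainCount (Cell α β) l' := by
  have key := coeff_eq_of_mem_Sym h (d := listContent l) (e := listContent l') (by
    rw [map_support_listContent, map_support_listContent, Multiset.coe_eq_coe.2 hl])
  rw [weakAdvExt_eq, weakAdvExt_eq, Nat.cast_inj] at key
  rw [chainCount_eq, chainCount_eq, key]

/-- If the function of a connected diagram is symmetric, then its cells form a chain. -/
theorem le_total_of_mem_Sym (h : weakAdvExt α β ∈ Sym)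
    (hconn : Connected α β) (c d : Cell α β) : c ≤ d ∨ d ≤ c := by
  obtain ⟨f, hf, hf'⟩ := exists_chain_partition fun l l' => chainCount_perm h (l := l) (l' := l')
  by_contra hcd
  have hne : f c ≠ f d := fun e => hcd (hf' _ _ e)
  have hrow : ∀ a b : Cell α β, a.val.1.1 = b.val.1.1 → f a = f b := by
    intro a b hab
    rcases le_total a.val.1.2 b.val.1.2 with h | h
    · exact hf _ _ (Relation.ReflTransGen.single (Or.inl ⟨hab, h⟩))
    · exact (hf _ _ (Relation.ReflTransGen.single (Or.inl ⟨hab.symm, h⟩))).symm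
  have hcol : ∀ a b : Cell α β, a.val.1.2 = b.val.1.2 → f a = f b := by
    intro a b hab
    rcases le_total a.val.1.1 b.val.1.1 with h | h
    · exact hf _ _ (Relation.ReflTransGen.single (Or.inr ⟨hab, h⟩))
    · exact (hf _ _ (Relation.ReflTransGen.single (Or.inr ⟨hab.symm, h⟩))).symm
  have hlt : ∀ a : Cell α β, a.val.1.1 < α.length := fun a => ((mem_cells α β _ _).1 a.val.2).1
  -- All cells of a row, and all cells of a column, lie in one chain. Hence the rows in the chain of
  -- `c` share no column with the remaining rows.
  refine hconn ⟨{i | i < α.length ∧ ∃ a : Cell α β, a.val.1.1 = i ∧ f a = f c},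
    {i | i < α.length ∧ ∀ a : Cell α β, a.val.1.1 = i → f a ≠ f c},
    ⟨c.val.1.1, hlt c, c, rfl, rfl⟩,
    ⟨d.val.1.1, hlt d, fun a ha e => hne (e.symm.trans (hrow _ _ ha))⟩, ?_, ?_, ?_⟩
  · rw [Set.disjoint_left]
    rintro i ⟨-, a, ha, e⟩ ⟨-, h2⟩
    exact h2 a ha e
  · ext i
    constructor
    · rintro (h | h) <;> exact h.1
    · intro (hi : i < α.length)
      by_cases hex : ∃ a : Cell α β, a.val.1.1 = i ∧ f a = f c
      · exact Or.inl ⟨hi, hex⟩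
      · exact Or.inr ⟨hi, fun a ha e => hex ⟨a, ha, e⟩⟩
  · rw [Set.disjoint_left]
    rintro j ⟨i, ⟨-, a, ha, e⟩, hij⟩ ⟨i', ⟨-, h2⟩, hij'⟩
    refine h2 ⟨⟨(i', j), hij'⟩⟩ rfl ?_
    rw [← e, hrow a ⟨⟨(i, j), hij⟩⟩ ha]
    exact hcol _ _ rfl

/-! ### Diagrams whose cells form a chain. -/

/-- Padding by zeros lets the sizes of `α` and `β` be computed over the same range of rows. -/
theorem sum_part (c : Composition n) {L : ℕ} (hL : c.length ≤ L) :
    ∑ i ∈ Finset.range L, part c i = n := by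
  have h : ∀ l : List ℕ, ∀ L, l.length ≤ L → ∑ i ∈ Finset.range L, l.getD i 0 = l.sum := by
    intro l
    induction l with
    | nil => simp
    | cons a l ih =>
      intro L hL
      obtain ⟨L, rfl⟩ : ∃ L', L = L' + 1 := ⟨L - 1, by simp at hL; omega⟩
      rw [Finset.sum_range_succ']
      simp only [List.getD_cons_succ, List.getD_cons_zero, List.sum_cons]
      rw [ih L (by simpa using hL), add_comm]
  exact (h _ _ hL).trans c.blocks_sum

theorem part_antitone (hβ : IsPartition β) {i j : ℕ} (hij : i ≤ j) : part β j ≤ part β i := by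
  rcases lt_or_ge j β.blocks.length with hj | hj
  · rcases hij.eq_or_lt with rfl | hij
    · exact le_rfl
    · unfold part
      rw [List.getD_eq_getElem _ _ hj, List.getD_eq_getElem _ _ (hij.trans hj)]
      exact List.pairwise_iff_getElem.1 hβ _ _ _ _ hij
  · unfold part
    rw [List.getD_eq_default _ _ hj]
    exact Nat.zero_le _

theorem mem_diagram_onesThen {N k : ℕ} (hk : k < N) (i j : ℕ) :
    (i, j) ∈ diagram (onesThen N k hk) ↔ (i < k ∧ j = 0) ∨ (i = k ∧ j < N - k) := by
  have hlen : (onesThen N k hk).length = k + 1 := by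
    simp [Composition.length, onesThen]
  have h0 : part (Composition.ones 0) i = 0 := by
    simp [part, Composition.ones]
  rw [diagram, mem_cells, hlen, h0]
  rcases lt_trichotomy i k with h | h | h
  · have : part (onesThen N k hk) i = 1 := by
      unfold part onesThen
      rw [List.getD_append _ _ _ _ (by simpa using h)]
      simp [h]
    rw [this]
    omega
  · have : part (onesThen N k hk) i = N - k := by
      unfold part onesThen
      rw [List.getD_append_right _ _ _ _ (by simp [h])]
      simp [h]
    rw [this]
    omega
  · omega

/-- A diagram whose cells form a chain consists of single cells below a row. -/
theorem isDiagramOf_of_le_total (hn : 0 < n) (hβ : IsPartition β) (hsub : Contained β α)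
    (hrows : RowsNonempty α β) (htot : ∀ c d : Cell α β, c ≤ d ∨ d ≤ c) :
    ∃ (k : ℕ) (hk : k < n - m), IsDiagramOf α β (onesThen (n - m) k hk) := by
  have hlt : ∀ i < α.length, part β i < part α i := by
    intro i hi
    obtain ⟨j, hj⟩ := hrows i hi
    have := (mem_cells α β i j).1 hj
    omega
  have hcomp : ∀ i j i' j', (i, j) ∈ cells α β → (i', j') ∈ cells α β →
      (i ≤ i' ∧ j ≤ j') ∨ (i' ≤ i ∧ j' ≤ j) := by
    intro i j i' j' h h'
    rcases htot ⟨⟨(i, j), h⟩⟩ ⟨⟨(i', j'), h'⟩⟩ with h | h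
    · exact Or.inl (Cell.le_coord h)
    · exact Or.inr (Cell.le_coord h)
  obtain ⟨k, hk⟩ : ∃ k, α.length = k + 1 :=
    ⟨α.length - 1, by have := α.length_pos_of_pos hn; omega⟩
  -- The first cell of a lower row cannot lie to the right of the first cell of the top row `k`,
  -- while `β` weakly decreases.
  have hconst : ∀ i ≤ k, part β i = part β k := by
    intro i hi
    have h1 := part_antitone hβ hi
    have h2 := hcomp i (part β i) k (part β k)
      ((mem_cells _ _ _ _).2 ⟨by omega, le_rfl, hlt i (by omega)⟩)
      ((mem_cells _ _ _ _).2 ⟨by omega, le_rfl, hlt k (by omega)⟩)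
    rcases hi.eq_or_lt with rfl | hi
    · rfl
    · omega
  -- A second cell in row `i` would be below and to the right of the first cell of row `k`.
  have hone : ∀ i < k, part α i = part β i + 1 := by
    intro i hi
    by_contra hne
    have h1 := hlt i (by omega)
    have h2 := hcomp i (part β i + 1) k (part β k)
      ((mem_cells _ _ _ _).2 ⟨by omega, by omega, by omega⟩)
      ((mem_cells _ _ _ _).2 ⟨by omega, le_rfl, hlt k (by omega)⟩)
    have := hconst i hi.le
    omega
  have hsumα := sum_part α hk.le
  have hsumβ := sum_part β (hsub.1.trans hk.le)
  rw [Finset.sum_range_succ] at hsumα hsumβ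
  have hsum : ∑ i ∈ Finset.range k, part α i = (∑ i ∈ Finset.range k, part β i) + k := by
    rw [Finset.sum_congr rfl fun i hi => hone i (Finset.mem_range.1 hi), Finset.sum_add_distrib]
    simp
  have hltk := hlt k (by omega)
  refine ⟨k, by omega, part β k, ?_⟩
  ext ⟨i, j⟩
  simp only [mem_cells, Finset.mem_image, Prod.exists, mem_diagram_onesThen, Prod.mk.injEq]
  constructor
  · rintro ⟨hi, h1, h2⟩
    have := hconst i (by omega)
    refine ⟨i, j - part β k, ?_, rfl, by omega⟩
    rcases (Nat.lt_succ_iff.1 (hk ▸ hi)).lt_or_eq with hi | rfl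
    · have := hone i hi
      omega
    · omega
  · rintro ⟨i', j', h | h, rfl, rfl⟩
    · have := hconst i' h.1.le
      have := hone i' h.1
      omega
    · obtain ⟨rfl, h⟩ := h
      omega

/-- The cells of the diagram of `(1, …, 1, N - k)` form a chain. -/
theorem le_total_of_isDiagramOf {N k : ℕ} {hk : k < N} (h : IsDiagramOf α β (onesThen N k hk))
    (c d : Cell α β) : c ≤ d ∨ d ≤ c := by
  obtain ⟨s, hs⟩ := h
  have hmem : ∀ i j, (i, j) ∈ cells α β ↔ (i < k ∧ j = s) ∨ (i = k ∧ s ≤ j ∧ j < N - k + s) := by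
    intro i j
    rw [hs]
    simp only [Finset.mem_image, Prod.exists, mem_diagram_onesThen, Prod.mk.injEq]
    constructor
    · rintro ⟨i', j', h, rfl, rfl⟩
      omega
    · intro h
      exact ⟨i, j - s, by omega, rfl, by omega⟩
  -- Cells sharing neither row nor column are compared through this corner, where the column of
  -- single cells meets the long row.
  have hcor : (k, s) ∈ cells α β := (hmem _ _).2 (by omega)
  have main : ∀ c d : Cell α β, c.val.1.1 ≤ d.val.1.1 → c.val.1.2 ≤ d.val.1.2 → c ≤ d := by
    intro c d h1 h2
    have hc := (hmem c.val.1.1 c.val.1.2).1 c.val.2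
    have hd := (hmem d.val.1.1 d.val.1.2).1 d.val.2
    let e : Cell α β := ⟨⟨(k, s), hcor⟩⟩
    have single : ∀ a b : Cell α β, CellStep a b → a ≤ b := fun _ _ => Relation.ReflTransGen.single
    by_cases h3 : c.val.1.1 = d.val.1.1
    · exact single _ _ (Or.inl ⟨h3, h2⟩)
    by_cases h4 : c.val.1.2 = d.val.1.2
    · exact single _ _ (Or.inr ⟨h4, h1⟩)
    · refine (single c e (Or.inr ⟨?_, ?_⟩)).trans (single e d (Or.inl ⟨?_, ?_⟩)) <;>
        simp only [e] <;> omega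
  have hc := (hmem c.val.1.1 c.val.1.2).1 c.val.2
  have hd := (hmem d.val.1.1 d.val.1.2).1 d.val.2
  by_cases h : c.val.1.1 ≤ d.val.1.1 ∧ c.val.1.2 ≤ d.val.1.2
  · exact Or.inl (main _ _ h.1 h.2)
  · exact Or.inr (main _ _ (by omega) (by omega))

/-! ### The function of a chain is complete homogeneous. -/

/-- The number of monotone maps of a given content on a finite chain. -/
theorem card_monotone_chain {P : Type*} [PartialOrder P] [Fintype P]
    (htot : ∀ x y : P, x ≤ y ∨ y ≤ x) (d : ℕ+ →₀ ℕ) :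
    Nat.card {T : P → ℕ+ // Monotone T ∧ ∑ c, Finsupp.single (T c) 1 = d} =
      if d.degree = Fintype.card P then 1 else 0 := by
  classical
  let lin : LinearOrder P :=
    { (inferInstance : PartialOrder P) with
      le_total := htot
      toDecidableLE := Classical.decRel _ }
  obtain ⟨e⟩ : Nonempty (Fin (Fintype.card P) ≃o P) :=
    ⟨Fintype.orderIsoFinOfCardEq P rfl⟩
  set l := (Finsupp.toMultiset d).sort with hl
  have hsum : ∀ T : P → ℕ+, (↑(List.ofFn (T ∘ e)) : Multiset ℕ+) =
      Finsupp.toMultiset (∑ c, Finsupp.single (T c) 1) := by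
    intro T
    rw [map_sum, ← Equiv.sum_comp e.toEquiv, List.ofFn_eq_map, ← Multiset.map_coe,
      ← Multiset.sum_map_singleton (Multiset.map _ _), Multiset.map_map]
    simp only [Finsupp.toMultiset_single, one_smul]
    rfl
  -- Read along the chain, a monotone map is the sorted list of its values, so its content
  -- determines it.
  have hiff : ∀ T : P → ℕ+, (Monotone T ∧ ∑ c, Finsupp.single (T c) 1 = d) ↔
      List.ofFn (T ∘ e) = l := by
    intro T
    constructor
    · rintro ⟨h1, rfl⟩
      refine List.Perm.eq_of_pairwise' (r := (· ≤ ·)) ?_ (Multiset.pairwise_sort _ _) ?_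
      · exact (h1.comp e.monotone).sortedLE_ofFn.pairwise
      · rw [← Multiset.coe_eq_coe, hsum, hl, Multiset.sort_eq]
    · intro h
      constructor
      · have hs : (List.ofFn (T ∘ e)).SortedLE := by
          rw [h]
          exact (Multiset.pairwise_sort _ _).sortedLE
        have := (List.sortedLE_ofFn_iff.1 hs).comp e.symm.monotone
        rwa [Function.comp_assoc, show e ∘ e.symm = id from funext e.apply_symm_apply,
          Function.comp_id] at this
      · have h1 := hsum T
        rw [h, hl, Multiset.sort_eq] at h1
        exact by
          rw [← Finsupp.toMultiset_toFinsupp d, h1, Finsupp.toMultiset_toFinsupp]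
  have hlen : l.length = d.degree := by
    rw [hl, Multiset.length_sort, Finsupp.card_toMultiset]
    rfl
  simp only [hiff, ← hlen]
  split_ifs with hd
  · rw [Nat.card_eq_one_iff_unique]
    refine ⟨⟨fun T T' => Subtype.ext ?_⟩, ?_⟩
    · have := List.ofFn_injective (T.2.trans T'.2.symm)
      exact e.surjective.injective_comp_right this
    · have hex : ∀ (N : ℕ) (l : List ℕ+), l.length = N → ∃ f : Fin N → ℕ+, List.ofFn f = l := by
        rintro N l rfl
        exact ⟨l.get, List.ofFn_get l⟩
      obtain ⟨f, hf⟩ := hex _ l hd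
      exact ⟨⟨f ∘ e.symm, by
        rwa [Function.comp_assoc, show e.symm ∘ e = id from funext e.symm_apply_apply,
          Function.comp_id]⟩⟩
  · have : IsEmpty {T : P → ℕ+ // List.ofFn (T ∘ e) = l} :=
      ⟨fun T => hd (by rw [← T.2, List.length_ofFn])⟩
    rw [Nat.card_of_isEmpty]

/-- The function of a chain is symmetric. -/
theorem mem_Sym_of_le_total (htot : ∀ c d : Cell α β, c ≤ d ∨ d ≤ c) : weakAdvExt α β ∈ Sym := by
  classical
  set N := Fintype.card (Cell α β)
  -- Each monomial of degree `N` has coefficient one and occurs in exactly one `monomialSymm μ`,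
  -- where `μ` is its multiset of nonzero exponents.
  have h : weakAdvExt α β = ∑ μ : N.Partition, monomialSymm μ := by
    funext d
    rw [weakAdvExt_eq, card_monotone_chain htot]
    have happ : (∑ μ : N.Partition, monomialSymm μ) d = ∑ μ : N.Partition, monomialSymm μ d :=
      Finset.sum_apply d _ _
    rw [happ]
    simp only [monomialSymm]
    have hdeg : d.degree = (d.support.val.map d).sum := rfl
    split_ifs with hd
    · let μ : N.Partition := ⟨d.support.val.map d, by
        intro i hi
        obtain ⟨k, hk, rfl⟩ := Multiset.mem_map.1 hi
        exact Nat.pos_of_ne_zero (Finsupp.mem_support_iff.1 hk), hd⟩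
      rw [Finset.sum_eq_single μ]
      · simp [μ]
      · intro ν _ hν
        rw [if_neg]
        exact fun e => hν (Nat.Partition.ext e.symm)
      · exact fun hn => absurd (Finset.mem_univ _) hn
    · rw [Nat.cast_zero, Finset.sum_eq_zero]
      intro μ _
      rw [if_neg]
      intro e
      rw [hdeg, e, μ.parts_sum] at hd
      exact hd rfl
  rw [h]
  exact Submodule.mem_iSup_of_mem N
    (Submodule.sum_mem _ fun μ _ => Submodule.subset_span ⟨μ, rfl⟩)

end SkewComp

end

theorem theorem5p6 {n m : ℕ} (hn : 0 < n) (α : Composition n) (lam : Composition m)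
    (hlam : SkewComp.IsPartition lam) (hsub : SkewComp.Contained lam α)
    (hrows : SkewComp.RowsNonempty α lam) (hconn : SkewComp.Connected α lam) :
    SkewComp.weakAdvExt α lam ∈ SkewComp.Sym ↔
      ∃ (k : ℕ) (hk : k < n - m),
        SkewComp.IsDiagramOf α lam (SkewComp.onesThen (n - m) k hk) :=
  ⟨fun h => SkewComp.isDiagramOf_of_le_total hn hlam hsub hrows
      (SkewComp.le_total_of_mem_Sym h hconn),
    fun ⟨_, _, h⟩ => SkewComp.mem_Sym_of_le_total (SkewComp.le_total_of_isDiagramOf h)⟩
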